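/- Throughout, graphs are simple and $V(G)=\{1,\dots,n\}$. The degeneracy $\kappa=\kappa(G)$ is the least $k$ such that every non-empty induced subgraph of $G$ has a vertex of degree at most $k$ in that subgraph. An edge stream of $G$ lists the edges of $G$, each exactly once, in arbitrary order. A randomized one-pass streaming algorithm with $s$ bits of space, for $n$-vertex graphs, is a probability distribution on deterministic algorithms that keep a memory in $\{0,1\}^s$, update it upon each arriving edge (as a function of the memory and the edge), and produce their output from the final memory content; the random string is not charged as space. It performs a task if, for every $n$-vertex graph $G$ and every edge stream of $G$, its output is correct with probability at least $2/3$. For $\lambda\ge 1$ an integer, consider the tasks (i) produce a proper colouring of $G$ with at most $\kappa+\lambda$ colours; (ii) produce a real number $\hat\kappa$ with $|\hat\kappa-\kappa|\le\lambda$. Neither $\kappa$ nor any other information about $G$ except $n$ is given in advance. **Theorem.** (a) Each of the tasks (i), (ii) requires $\Omega(n^2/\lambda^2)$ bits of space: there are absolute constants $c>0$ and $C$ such that for all integers $\lambda\ge 1$ and $n\ge C\lambda$, every randomized one-pass streaming algorithm that performs task (i), or task (ii), for $n$-vertex graphs uses at least $c\,n^2/\lambda^2$ bits of space. (b) Let $\gamma>0$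 and let $\lambda=\lambda(\kappa)\ge 1$ be an integer-valued function of $\kappa$ with $\lambda(\kappa)=O(\kappa^{1/2-\gamma})$ as $\kappa\to\infty$. Then neither task, with $\lambda=\lambda(\kappa(G))$, admits a semi-streaming algorithm: if $s(n)=O(n(\log n)^k)$ for some $k$, then for all sufficiently large $n$ no randomized one-pass streaming algorithm with $s(n)$ bits of space performs task (i) for $n$-vertex graphs, and none performs task (ii). -/

import Mathlib

open Filter Asymptotics

/-- `G` is `k`-degenerate: every induced subgraph (on a nonempty vertex set `S`) has a vertex
whose degree in that induced subgraph is at most `k`. -/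
def IsDegenerate {V : Type*} [Finite V] (G : SimpleGraph V) (k : ℕ) : Prop :=
  ∀ S : Set V, S.Nonempty → ∃ v ∈ S, {u ∈ S | G.Adj v u}.ncard ≤ k

/-- The degeneracy `κ(G)`: the smallest `k` such that `G` is `k`-degenerate. -/
noncomputable def degeneracy {V : Type*} [Finite V] (G : SimpleGraph V) : ℕ :=
  sInf {k | IsDegenerate G k}

/-- `col` is a proper colouring of `G` using at most `c` colours. The names of the colours are
irrelevant, only their number counts; in particular every proper map into `{1, …, c}` qualifies. -/
def IsProperColoring {n : ℕ} (G : SimpleGraph (Fin n)) (c : ℕ) (col : Fin n → ℕ) : Prop :=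
  (∀ u v, G.Adj u v → col u ≠ col v) ∧ (Finset.univ.image col).card ≤ c

/-- The edge stream `σ` builds up `G` in the insertion-only model: it lists every edge of `G`
exactly once, in some order. -/
def IsEdgeStream {n : ℕ} (G : SimpleGraph (Fin n)) (σ : List (Sym2 (Fin n))) : Prop :=
  σ.Nodup ∧ ∀ e, e ∈ σ ↔ e ∈ G.edgeSet

/-- A deterministic one-pass streaming algorithm with `s` bits of memory for edge streams on the
vertex set `Fin n`: an initial memory content, an update for each arriving edge, and an output
read off from the final memory content. -/
structure StreamAlg (n s : ℕ) (Out : Type) where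
  init : Fin s → Bool
  step : (Fin s → Bool) → Sym2 (Fin n) → (Fin s → Bool)
  out : (Fin s → Bool) → Out

/-- The output of the algorithm after one pass over the stream `σ`. -/
def StreamAlg.run {n s : ℕ} {Out : Type} (D : StreamAlg n s Out) (σ : List (Sym2 (Fin n))) : Out :=
  D.out (σ.foldl D.step D.init)

/-- A randomized one-pass streaming algorithm with `s` bits of memory: a probability distribution
on deterministic ones, that is, the random string is not charged as space. As no edge occurs twice
in a stream, this also covers algorithms that toss fresh coins at every update (the coins for the
arrival of the edge `e` are a separate part of the random string). -/
abbrev RandStreamAlg (n s : ℕ) (Out : Type) := PMF (StreamAlg n s Out)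

/-- `A` performs the task "output some `o` with `Good G o`" with success probability at least
`2/3`: for every input graph `G` on `n` vertices and every ordering of its edge stream. -/
def RandStreamAlg.Solves {n s : ℕ} {Out : Type} (A : RandStreamAlg n s Out)
    (Good : SimpleGraph (Fin n) → Out → Prop) : Prop :=
  ∀ (G : SimpleGraph (Fin n)) (σ : List (Sym2 (Fin n))), IsEdgeStream G σ →
    2 / 3 ≤ A.toOuterMeasure {D | Good G (D.run σ)}

/-- Some randomized one-pass algorithm with `s` bits of memory produces, with probability at least
`2/3`, a proper `(κ + λ)`-colouring of every `n`-vertex input graph, where `κ` is the degeneracy of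
the graph; the number `λ = lam κ` is allowed to depend on `κ`. -/
def ColoringInSpace (n s : ℕ) (lam : ℕ → ℕ) : Prop :=
  ∃ A : RandStreamAlg n s (Fin n → ℕ),
    RandStreamAlg.Solves A fun G col => IsProperColoring G (degeneracy G + lam (degeneracy G)) col

/-- Some randomized one-pass algorithm with `s` bits of memory produces, with probability at least
`2/3`, an estimate of the degeneracy `κ` of every `n`-vertex input graph that is within `± λ`; the
number `λ = lam κ` is allowed to depend on `κ`. -/
def EstimationInSpace (n s : ℕ) (lam : ℕ → ℕ) : Prop :=
  ∃ A : RandStreamAlg n s ℝ,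
    RandStreamAlg.Solves A fun G est => |est - (degeneracy G : ℝ)| ≤ (lam (degeneracy G) : ℝ)

/-- The space bound of a semi-streaming algorithm: `Õ(n)` bits, that is, `O(n (log n) ^ k)` bits
for some `k`. -/
def IsSemiStreaming (s : ℕ → ℕ) : Prop :=
  ∃ k : ℕ, (fun n => (s n : ℝ)) =O[atTop] fun n => (n : ℝ) * Real.log n ^ k

/-!
The bound is a reduction from the communication problem INDEX: Alice holds one bit for each pair
`(i, j)`, sends one message to Bob, and Bob has to recover the bit of a pair of his choice. If this
succeeds with probability `2 / 3` for every input, then the message has a length linear in the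
number of bits. Indeed some fixed choice of the randomness recovers two thirds of the bits on
average over all inputs, whereas a Hamming ball whose radius is a third of the length contains few
inputs, so that there have to be many different messages.

Given a streaming algorithm, partition the vertices into small blocks of size `b`, one for every
vertex of a bipartite graph `H` that has the bits of Alice as its adjacencies, and a hub that
contains half of the vertices. Alice feeds the blow-up of `H` to the algorithm and sends its memory.
Bob, who wants to know whether `a` and `c` are adjacent in `H`, adds all edges within the hub and
the blocks of `a` and `c` except for those between the two blocks. All other vertices miss the hub,
so they have small degree and do not matter for the degeneracy. If `a` and `c` are adjacent, then
the two blocks and the hub form a clique and `κ = q + 2 b - 1`, where `q` is the size of the hub;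
otherwise `κ = q + b - 1`. An estimate of `κ` with error less than `b / 2` tells these apart. A
colouring with fewer than `q + 2 b` colours of the graph with `a` and `c` not adjacent repeats a
colour within the two blocks and the hub, and this is possible only for one vertex in each block;
such a repetition is excluded if `a` and `c` are adjacent.

With `b` of order `λ` there is room for `n / b` blocks, hence for `n ^ 2 / λ ^ 2` bits. As both
possible values of `κ` lie between `n / 2` and `n`, a slack `λ(κ) = O(κ ^ δ)` amounts to a slack
`O(n ^ δ)`, and the space is `Ω(n ^ (2 - 2 δ))`.
-/

open scoped BigOperators Finset

section FirstMoment

open MeasureTheory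

lemma exists_mul_card_le_card_filter_mem {Ω α : Type*} [MeasurableSpace Ω] [Fintype α]
    (μ : Measure Ω) [IsProbabilityMeasure μ] (E : α → Set Ω) [∀ ω, DecidablePred (ω ∈ E ·)]
    (hE : ∀ a, MeasurableSet (E a)) {r : ENNReal} (hr : ∀ a, r ≤ μ (E a)) :
    ∃ ω, r * Fintype.card α ≤ #{a | ω ∈ E a} := by
  have hlintegral : ∫⁻ ω, (#{a | ω ∈ E a} : ENNReal) ∂μ = ∑ a, μ (E a) := by
    have hcount (ω : Ω) : (#{a | ω ∈ E a} : ENNReal) = ∑ a, (E a).indicator 1 ω := by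
      simp [Set.indicator_apply]
    simp_rw [hcount]
    rw [lintegral_finsetSum _ fun a _ => measurable_one.indicator (hE a)]
    exact Finset.sum_congr rfl fun a _ => lintegral_indicator_one (hE a)
  obtain ⟨ω, hω⟩ := exists_lintegral_le (μ := μ)
    (f := fun ω => (#{a | ω ∈ E a} : ENNReal))
    (by simp [hlintegral, ENNReal.sum_eq_top])
  refine ⟨ω, le_trans ?_ hω⟩
  rw [hlintegral, mul_comm, ← nsmul_eq_mul]
  exact Finset.card_nsmul_le_sum _ _ _ fun a _ => hr a

end FirstMoment

section HammingDistance

variable {ι α M : Type*} [Fintype ι] [Fintype α] [Fintype M] [DecidableEq α]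

lemma rpow_expect_le_expect_rpow {X : Type*} [Fintype X] [Nonempty X] {t : ℝ} (ht : 0 < t)
    (f : X → ℝ) : t ^ (𝔼 x, f x) ≤ 𝔼 x, t ^ f x := by
  have hweights : ∑ _x : X, (Fintype.card X : ℝ)⁻¹ = 1 := by simp
  simpa [Fintype.expect_eq_sum_div_card, ← Finset.mul_sum, div_eq_inv_mul] using
    (convexOn_rpow_left ht).map_sum_le (t := Finset.univ) (p := f) (fun _ _ => by positivity)
      hweights fun _ _ => Set.mem_univ _

lemma sum_pow_hammingDist [DecidableEq ι] {R : Type*} [CommSemiring R] (t : R) (y : ι → α) :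
    ∑ x : ι → α, t ^ hammingDist x y = (1 + (Fintype.card α - 1 : ℕ) * t) ^ Fintype.card ι := by
  have hcoord (b : α) : ∑ a : α, (if a ≠ b then t else 1) = 1 + (Fintype.card α - 1 : ℕ) * t := by
    rw [Fintype.sum_eq_add_sum_compl b, Finset.sum_congr rfl fun a ha => if_pos (by simpa using ha)]
    simp [Finset.card_compl]
  calc ∑ x : ι → α, t ^ hammingDist x y
      = ∑ x : ι → α, ∏ i, (if x i ≠ y i then t else 1) := by
        simp [hammingDist, Finset.prod_ite]
    _ = ∏ i, ∑ a : α, (if a ≠ y i then t else 1) :=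
        (Fintype.prod_sum fun i a => if a ≠ y i then t else 1).symm
    _ = (1 + (Fintype.card α - 1 : ℕ) * t) ^ Fintype.card ι := by
        simp_rw [hcoord, Finset.prod_const, Finset.card_univ]

lemma sum_hammingDist_add_card_agree [DecidableEq ι] (f : (ι → α) → ι → α) :
    ∑ x, hammingDist x (f x) + #{a : (ι → α) × ι | f a.1 a.2 = a.1 a.2} =
      Fintype.card α ^ Fintype.card ι * Fintype.card ι := by
  have hdisagree : ∑ x, hammingDist x (f x) =
      #{a : (ι → α) × ι | ¬ f a.1 a.2 = a.1 a.2} := by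
    simp only [hammingDist, Finset.card_filter, Fintype.sum_prod_type, ne_eq, eq_comm]
  rw [hdisagree, add_comm, Finset.card_filter_add_card_filter_not, Finset.card_univ,
    Fintype.card_prod, Fintype.card_fun]

lemma card_pow_mul_rpow_expect_hammingDist_le [DecidableEq ι] [Nonempty α] {t : ℝ} (ht : 0 < t)
    (enc : (ι → α) → M) (dec : M → ι → α) :
    (Fintype.card α : ℝ) ^ Fintype.card ι * t ^ (𝔼 x, (hammingDist x (dec (enc x)) : ℝ)) ≤
      Fintype.card M * (1 + (Fintype.card α - 1 : ℕ) * t) ^ Fintype.card ι := by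
  have hcard : (Fintype.card (ι → α) : ℝ) = (Fintype.card α : ℝ) ^ Fintype.card ι := by simp
  have hpos : (0 : ℝ) < Fintype.card (ι → α) := by exact_mod_cast Fintype.card_pos
  calc (Fintype.card α : ℝ) ^ Fintype.card ι * t ^ (𝔼 x, (hammingDist x (dec (enc x)) : ℝ))
      ≤ Fintype.card (ι → α) * 𝔼 x, t ^ (hammingDist x (dec (enc x)) : ℝ) := by
        rw [hcard]
        gcongr
        exact rpow_expect_le_expect_rpow ht _
    _ = ∑ x, t ^ hammingDist x (dec (enc x)) := by
        rw [Fintype.expect_eq_sum_div_card, mul_div_cancel₀ _ hpos.ne']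
        simp_rw [Real.rpow_natCast]
    _ ≤ ∑ x, ∑ m, t ^ hammingDist x (dec m) :=
        Finset.sum_le_sum fun x _ => Finset.single_le_sum
          (f := fun m => t ^ hammingDist x (dec m)) (fun _ _ => by positivity)
          (Finset.mem_univ (enc x))
    _ = Fintype.card M * (1 + (Fintype.card α - 1 : ℕ) * t) ^ Fintype.card ι := by
        rw [Finset.sum_comm]
        simp_rw [sum_pow_hammingDist, Finset.sum_const, Finset.card_univ, nsmul_eq_mul]

lemma two_pow_card_le_card_pow_of_expect_hammingDist_le [DecidableEq ι]
    (enc : (ι → Bool) → M) (dec : M → ι → Bool)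
    (h : 𝔼 x, (hammingDist x (dec (enc x)) : ℝ) ≤ Fintype.card ι / 3) :
    2 ^ Fintype.card ι ≤ Fintype.card M ^ 15 := by
  -- For `t = 1 / 2` the preceding bound reads `2 ^ N * (1 / 2) ^ (N / 3) ≤ |M| * (3 / 2) ^ N`, and
  -- the 15th powers leave a factor `2 ^ N`, since `2 * (3 / 2) ^ 15 ≤ 2 ^ 10`.
  set N := Fintype.card ι
  have hcode : (2 : ℝ) ^ N * (1 / 2) ^ (N / 3 : ℝ) ≤ Fintype.card M * (3 / 2) ^ N := by
    calc (2 : ℝ) ^ N * (1 / 2) ^ (N / 3 : ℝ)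
        ≤ 2 ^ N * (1 / 2) ^ (𝔼 x, (hammingDist x (dec (enc x)) : ℝ)) :=
          mul_le_mul_of_nonneg_left
            (Real.rpow_le_rpow_of_exponent_ge (by norm_num) (by norm_num) h) (by positivity)
      _ ≤ Fintype.card M * (3 / 2) ^ N := by
          have := card_pow_mul_rpow_expect_hammingDist_le one_half_pos enc dec
          norm_num at this ⊢
          exact this
  have hroot : ((1 / 2 : ℝ) ^ (N / 3 : ℝ)) ^ 15 = (1 / 2 ^ 5) ^ N := by
    rw [← Real.rpow_mul_natCast (by norm_num), ← one_div_pow, ← pow_mul, ← Real.rpow_natCast]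
    congr 1
    push_cast
    ring
  have hpow : ((2 : ℝ) ^ 10) ^ N ≤ Fintype.card M ^ 15 * ((3 / 2) ^ 15) ^ N := by
    calc ((2 : ℝ) ^ 10) ^ N = ((2 : ℝ) ^ 15 * (1 / 2 ^ 5)) ^ N := by norm_num
      _ = ((2 : ℝ) ^ N * (1 / 2) ^ (N / 3 : ℝ)) ^ 15 := by
          rw [mul_pow, mul_pow, hroot, pow_right_comm]
      _ ≤ (Fintype.card M * (3 / 2) ^ N) ^ 15 := by gcongr
      _ = Fintype.card M ^ 15 * ((3 / 2) ^ 15) ^ N := by rw [mul_pow, pow_right_comm]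
  have hnum : (2 : ℝ) * (3 / 2) ^ 15 ≤ 2 ^ 10 := by norm_num
  have : (2 : ℝ) ^ N * ((3 / 2) ^ 15) ^ N ≤ Fintype.card M ^ 15 * ((3 / 2) ^ 15) ^ N := by
    rw [← mul_pow]
    exact (pow_le_pow_left₀ (by positivity) hnum N).trans hpow
  exact_mod_cast le_of_mul_le_mul_right this (by positivity)

end HammingDistance

section Index

lemma two_pow_card_le_card_pow_of_forall_two_thirds_le {Ω ι M : Type*} [Fintype ι] [Fintype M]
    (A : PMF Ω) (enc : Ω → (ι → Bool) → M) (dec : Ω → M → ι → Bool)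
    (h : ∀ x i, 2 / 3 ≤ A.toOuterMeasure {ω | dec ω (enc ω x) i = x i}) :
    2 ^ Fintype.card ι ≤ Fintype.card M ^ 15 := by
  classical
  let _ : MeasurableSpace Ω := ⊤
  obtain ⟨ω, hω⟩ := exists_mul_card_le_card_filter_mem A.toMeasure
    (fun a : (ι → Bool) × ι => {ω | dec ω (enc ω a.1) a.2 = a.1 a.2}) (fun _ => trivial)
    fun a => (h a.1 a.2).trans (A.toOuterMeasure_apply_le_toMeasure_apply _)
  refine two_pow_card_le_card_pow_of_expect_hammingDist_le (enc ω) (dec ω) ?_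
  have hagree := sum_hammingDist_add_card_agree fun x => dec ω (enc ω x)
  simp only [Set.mem_ofPred_eq, Fintype.card_prod, Fintype.card_fun, Fintype.card_bool] at hω hagree
  replace hω : (2 / 3 : ℝ) * (2 ^ Fintype.card ι * Fintype.card ι) ≤
      #{a : (ι → Bool) × ι | dec ω (enc ω a.1) a.2 = a.1 a.2} := by
    simpa using ENNReal.toReal_mono (by simp) hω
  replace hagree := congrArg (Nat.cast (R := ℝ)) hagree
  push_cast at hagree
  rw [Fintype.expect_eq_sum_div_card, div_le_iff₀ (by positivity)]
  simp only [Fintype.card_fun, Fintype.card_bool]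
  push_cast
  linarith

end Index

section Degeneracy

variable {V : Type*} [Finite V] {G : SimpleGraph V} {k : ℕ}

lemma ncard_adj_le_of_forall_mem {S T : Set V} {v : V} (hv : v ∈ T) (hcard : T.ncard ≤ k + 1)
    (h : ∀ u ∈ S, G.Adj v u → u ∈ T) : {u ∈ S | G.Adj v u}.ncard ≤ k := by
  have hsub : {u ∈ S | G.Adj v u} ⊆ T \ {v} := fun u hu => ⟨h u hu.1 hu.2, hu.2.ne'⟩
  have := Set.ncard_sdiff_singleton_add_one hv T.toFinite
  have := Set.ncard_le_ncard hsub (Set.toFinite _)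
  omega

lemma IsDegenerate.ncard_le_of_isClique (h : IsDegenerate G k) {K : Set V} (hK : G.IsClique K) :
    K.ncard ≤ k + 1 := by
  rcases K.eq_empty_or_nonempty with rfl | hne
  · simp
  obtain ⟨v, hv, hdeg⟩ := h K hne
  have hsub : K \ {v} ⊆ {u ∈ K | G.Adj v u} :=
    fun u hu => ⟨hu.1, hK hv hu.1 fun huv => hu.2 huv.symm⟩
  have := Set.ncard_sdiff_singleton_add_one hv K.toFinite
  have := Set.ncard_le_ncard hsub (Set.toFinite _)
  omega

lemma degeneracy_eq_of_isClique (h : IsDegenerate G k) {K : Set V} (hK : G.IsClique K)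
    (hcard : K.ncard = k + 1) : degeneracy G = k :=
  le_antisymm (Nat.sInf_le h) <| le_csInf ⟨k, h⟩ fun j hj => by
    have := IsDegenerate.ncard_le_of_isClique hj hK
    omega

end Degeneracy

section Gadget

variable {V W : Type*}

/-- The blow-up of `H` along a partition `B` of `V` into independent blocks: the block of a vertex
`u` is `B u`, where `some a` stands for the vertex `a` of `H` and the vertices of the block `none`,
the hub, are isolated. -/
def blowUp (B : V → Option W) (H : SimpleGraph W) : SimpleGraph V :=
  (H.map Function.Embedding.some).comap B

/-- The vertices of the core of the query `(a, c)`: the blocks of `a` and `c` and the hub. -/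
def core (B : V → Option W) (a c : W) : Set V :=
  B ⁻¹' {some a, some c, none}

/-- The graph that queries the adjacency of `a` and `c`: the complete graph on the core, except that
the blocks of `a` and `c` are not joined. -/
def queryGraph (B : V → Option W) (a c : W) : SimpleGraph V :=
  (⊤ : SimpleGraph V).between (core B a c) (core B a c) \ blowUp B (SimpleGraph.edge a c)

/-- The union of the edges that encode `H` and of those that query the adjacency of `a` and `c`. Its
degeneracy depends on whether `a` and `c` are adjacent in `H`. -/
def gadget (B : V → Option W) (H : SimpleGraph W) (a c : W) : SimpleGraph V :=
  blowUp B H ⊔ queryGraph B a c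

/-- The block of every vertex of `W` has size `b`, and the hub has size `q`. -/
structure IsBlockPartition (B : V → Option W) (b q : ℕ) : Prop where
  ncard_block : ∀ a, (B ⁻¹' {some a}).ncard = b
  ncard_hub : (B ⁻¹' {none}).ncard = q

variable {B : V → Option W} {H : SimpleGraph W} {a c : W} {u v : V}

lemma blowUp_adj : (blowUp B H).Adj u v ↔ ∃ x y, H.Adj x y ∧ some x = B u ∧ some y = B v :=
  SimpleGraph.map_adj ..

lemma blowUp_edge_adj (hac : a ≠ c) : (blowUp B (.edge a c)).Adj u v ↔
    B u = some a ∧ B v = some c ∨ B u = some c ∧ B v = some a := by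
  simp only [blowUp_adj, SimpleGraph.edge_adj]
  grind

lemma queryGraph_adj : (queryGraph B a c).Adj u v ↔
    u ≠ v ∧ u ∈ core B a c ∧ v ∈ core B a c ∧ ¬ (blowUp B (.edge a c)).Adj u v := by
  simp [queryGraph, SimpleGraph.between_adj, and_assoc]

lemma disjoint_blowUp_queryGraph : Disjoint (blowUp B H) (queryGraph B a c) := by
  rw [SimpleGraph.disjoint_left]
  intro u v huv hquery
  obtain ⟨-, hu, hv, hedge⟩ := queryGraph_adj.1 hquery
  obtain ⟨x, y, hxy, hx, hy⟩ := blowUp_adj.1 huv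
  have hxac : x = a ∨ x = c := by simpa [core, ← hx] using hu
  have hyac : y = a ∨ y = c := by simpa [core, ← hy] using hv
  refine hedge (blowUp_adj.2 ⟨x, y, ?_, hx, hy⟩)
  have := hxy.ne
  grind

lemma gadget_adj_or_blowUp_edge_adj (hu : u ∈ core B a c) (hv : v ∈ core B a c) (huv : u ≠ v) :
    (gadget B H a c).Adj u v ∨ (blowUp B (.edge a c)).Adj u v := by
  by_cases h : (blowUp B (.edge a c)).Adj u v
  · exact .inr h
  · exact .inl (.inr (queryGraph_adj.2 ⟨huv, hu, hv, h⟩))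

lemma isClique_gadget_core (h : H.Adj a c) : (gadget B H a c).IsClique (core B a c) := by
  intro u hu v hv huv
  refine (gadget_adj_or_blowUp_edge_adj hu hv huv).elim id fun hedge => .inl ?_
  obtain ⟨x, y, hxy, hx, hy⟩ := blowUp_adj.1 hedge
  exact blowUp_adj.2 ⟨x, y, (SimpleGraph.edge_le_iff H).2 (.inr h) hxy, hx, hy⟩

lemma isClique_gadget_block_union_hub (hac : a ≠ c) :
    (gadget B H a c).IsClique (B ⁻¹' {some a, none}) := by
  have hsub : B ⁻¹' {some a, none} ⊆ core B a c := Set.preimage_mono (by grind)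
  intro u hu v hv huv
  refine (gadget_adj_or_blowUp_edge_adj (hsub hu) (hsub hv) huv).resolve_right ?_
  rw [blowUp_edge_adj hac]
  grind

lemma not_gadget_adj (hac : a ≠ c) (h : ¬ H.Adj a c) (hu : B u = some a) (hv : B v = some c) :
    ¬ (gadget B H a c).Adj u v := by
  rintro (hblow | hquery)
  · obtain ⟨x, y, hxy, hx, hy⟩ := blowUp_adj.1 hblow
    grind
  · exact (queryGraph_adj.1 hquery).2.2.2 ((blowUp_edge_adj hac).2 (.inl ⟨hu, hv⟩))

lemma ne_none_of_gadget_adj (hu : u ∉ core B a c) (h : (gadget B H a c).Adj u v) : B v ≠ none := by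
  rcases h with hblow | hquery
  · obtain ⟨_, _, _, _, hv⟩ := blowUp_adj.1 hblow
    simp [← hv]
  · exact absurd (queryGraph_adj.1 hquery).2.1 hu

variable [Finite V] {b q k : ℕ}

lemma IsBlockPartition.ncard_block_union_hub (hB : IsBlockPartition B b q) (a : W) :
    (B ⁻¹' {some a, none}).ncard = q + b := by
  rw [Set.insert_eq, Set.preimage_union, Set.ncard_union_eq (Disjoint.preimage B (by simp)),
    hB.ncard_block, hB.ncard_hub, add_comm]

lemma IsBlockPartition.ncard_core (hB : IsBlockPartition B b q) (hac : a ≠ c) :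
    (core B a c).ncard = q + 2 * b := by
  rw [core, Set.insert_eq, Set.preimage_union,
    Set.ncard_union_eq (Disjoint.preimage B (by simp [hac])), hB.ncard_block,
    hB.ncard_block_union_hub]
  ring

lemma IsBlockPartition.ncard_gadget_adj_le (hB : IsBlockPartition B b q) (hq : Nat.card V ≤ 2 * q)
    (hv : v ∉ core B a c) (S : Set V) : {u ∈ S | (gadget B H a c).Adj v u}.ncard ≤ q := by
  -- Outside the core no vertex has a neighbour in the hub, which holds half of the vertices.
  have hsub : {u ∈ S | (gadget B H a c).Adj v u} ⊆ (B ⁻¹' {none})ᶜ :=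
    fun u hu => ne_none_of_gadget_adj hv hu.2
  have hhub := Set.ncard_add_ncard_compl (B ⁻¹' {none})
  rw [hB.ncard_hub] at hhub
  have := Set.ncard_le_ncard hsub (Set.toFinite _)
  omega

lemma IsBlockPartition.isDegenerate_gadget (hB : IsBlockPartition B b q)
    (hq : Nat.card V ≤ 2 * q) (hqk : q ≤ k)
    (hcore : ∀ S ⊆ core B a c, S.Nonempty →
      ∃ v ∈ S, {u ∈ S | (gadget B H a c).Adj v u}.ncard ≤ k) :
    IsDegenerate (gadget B H a c) k := by
  intro S hS
  by_cases hsub : S ⊆ core B a c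
  · exact hcore S hsub hS
  · obtain ⟨v, hv, hvcore⟩ := Set.not_subset.1 hsub
    exact ⟨v, hv, (hB.ncard_gadget_adj_le hq hvcore S).trans hqk⟩

lemma IsBlockPartition.degeneracy_gadget_of_adj (hB : IsBlockPartition B b q)
    (hq : Nat.card V ≤ 2 * q) (hb : 1 ≤ b) (h : H.Adj a c) :
    degeneracy (gadget B H a c) = q + 2 * b - 1 := by
  have hcard := hB.ncard_core h.ne
  refine degeneracy_eq_of_isClique (hB.isDegenerate_gadget hq (by omega) ?_)
    (isClique_gadget_core h) (by omega)
  rintro S hsub ⟨v, hv⟩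
  exact ⟨v, hv, ncard_adj_le_of_forall_mem (hsub hv) (by omega) fun u hu _ => hsub hu⟩

lemma IsBlockPartition.degeneracy_gadget_of_not_adj (hB : IsBlockPartition B b q)
    (hq : Nat.card V ≤ 2 * q) (hb : 1 ≤ b) (hac : a ≠ c) (h : ¬ H.Adj a c) :
    degeneracy (gadget B H a c) = q + b - 1 := by
  have hcard := hB.ncard_block_union_hub
  refine degeneracy_eq_of_isClique (hB.isDegenerate_gadget hq (by omega) ?_)
    (isClique_gadget_block_union_hub hac) (by rw [hcard]; omega)
  rintro S hsub ⟨v, hv⟩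
  by_cases hS : ∃ w ∈ S, B w = some c
  · obtain ⟨w, hw, hwc⟩ := hS
    refine ⟨w, hw, ncard_adj_le_of_forall_mem (T := B ⁻¹' {some c, none}) (.inl hwc)
      (by rw [hcard]; omega) fun u hu hwu => ?_⟩
    exact (hsub hu).resolve_left fun hua => not_gadget_adj hac h hua hwc hwu.symm
  · have hsub' : S ⊆ B ⁻¹' {some a, none} := fun u hu =>
      (hsub hu).imp_right fun hu' => hu'.resolve_left fun huc => hS ⟨u, hu, huc⟩
    exact ⟨v, hv, ncard_adj_le_of_forall_mem (hsub' hv) (by rw [hcard]; omega)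
      fun u hu _ => hsub' hu⟩

lemma IsBlockPartition.exists_map_eq_of_ncard_range_lt (hB : IsBlockPartition B b q)
    (hac : a ≠ c) {α : Type*} {col : V → α}
    (hcol : ∀ u v, (gadget B H a c).Adj u v → col u ≠ col v)
    (hcard : (Set.range col).ncard < q + 2 * b) :
    ∃ u v, B u = some a ∧ B v = some c ∧ col u = col v := by
  obtain ⟨u, hu, v, hv, huv, heq⟩ := Set.exists_ne_map_eq_of_ncard_lt_of_maps_to
    (by rwa [hB.ncard_core hac]) (fun u _ => Set.mem_range_self u) (Set.finite_range col)
  have hedge := (gadget_adj_or_blowUp_edge_adj hu hv huv).resolve_left fun h => hcol u v h heq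
  rcases (blowUp_edge_adj hac).1 hedge with ⟨hua, hvc⟩ | ⟨huc, hva⟩
  · exact ⟨u, v, hua, hvc, heq⟩
  · exact ⟨v, u, hva, huc, heq.symm⟩

lemma IsBlockPartition.adj_iff_forall_map_ne (hB : IsBlockPartition B b q) (hac : a ≠ c)
    {α : Type*} {col : V → α} (hcol : ∀ u v, (gadget B H a c).Adj u v → col u ≠ col v)
    (hcard : ¬ H.Adj a c → (Set.range col).ncard < q + 2 * b) :
    H.Adj a c ↔ ∀ u v, B u = some a → B v = some c → col u ≠ col v := by
  refine ⟨fun h u v hu hv => hcol u v (.inl (blowUp_adj.2 ⟨a, c, h, hu.symm, hv.symm⟩)), ?_⟩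
  contrapose!
  exact fun h => hB.exists_map_eq_of_ncard_range_lt hac hcol (hcard h)

end Gadget

section BlockPartition

lemma exists_forall_ncard_preimage_singleton_eq {V α : Type*} [Fintype V] [Fintype α]
    (size : α → ℕ) (h : ∑ a, size a = Fintype.card V) :
    ∃ f : V → α, ∀ a, (f ⁻¹' {a}).ncard = size a := by
  obtain ⟨e⟩ : Nonempty (V ≃ Σ a, Fin (size a)) := Fintype.card_eq.1 (by simp [h])
  refine ⟨fun v => (e v).1, fun a => ?_⟩
  have hfiber : (fun v => (e v).1) ⁻¹' {a} = Set.range (e.symm ∘ Sigma.mk a) := by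
    ext v
    refine ⟨?_, ?_⟩
    · rintro rfl
      exact ⟨(e v).2, by simp⟩
    · rintro ⟨t, rfl⟩
      simp
  rw [hfiber, ← Set.image_univ, Set.ncard_image_of_injective _
    (e.symm.injective.comp sigma_mk_injective), Set.ncard_univ, Nat.card_fin]

lemma exists_isBlockPartition {V W : Type*} [Fintype V] [Fintype W] {b q : ℕ}
    (h : Fintype.card W * b + q = Fintype.card V) :
    ∃ B : V → Option W, IsBlockPartition B b q := by
  obtain ⟨B, hB⟩ := exists_forall_ncard_preimage_singleton_eq (V := V)
    (fun a : Option W => a.elim q fun _ => b) (by simp [Fintype.sum_option, ← h, add_comm])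
  exact ⟨B, fun a => hB (some a), hB none⟩

end BlockPartition

section Streams

lemma isEdgeStream_append {n : ℕ} {G H : SimpleGraph (Fin n)} [Fintype G.edgeSet]
    [Fintype H.edgeSet] (h : Disjoint G H) :
    IsEdgeStream (G ⊔ H) (G.edgeFinset.toList ++ H.edgeFinset.toList) := by
  refine ⟨?_, fun e => by simp⟩
  refine (Finset.nodup_toList _).append (Finset.nodup_toList _) fun e heG heH => ?_
  exact Set.disjoint_left.1 (SimpleGraph.disjoint_edgeSet.2 h) (by simpa using heG)
    (by simpa using heH)

lemma card_le_of_solves {n s : ℕ} {Out : Type} {ι : Type*} [Fintype ι]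
    {A : RandStreamAlg n s Out} {Good : SimpleGraph (Fin n) → Out → Prop} (hA : A.Solves Good)
    (alice : (ι → Bool) → SimpleGraph (Fin n)) (bob : ι → SimpleGraph (Fin n))
    (hdisj : ∀ x i, Disjoint (alice x) (bob i)) (dec : ι → Out → Prop)
    (hdec : ∀ x i o, Good (alice x ⊔ bob i) o → (x i = true ↔ dec i o)) :
    Fintype.card ι ≤ 15 * s := by
  classical
  have hpow : 2 ^ Fintype.card ι ≤ Fintype.card (Fin s → Bool) ^ 15 :=
    two_pow_card_le_card_pow_of_forall_two_thirds_le A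
      (fun D x => (alice x).edgeFinset.toList.foldl D.step D.init)
      (fun D m i => decide (dec i (D.out ((bob i).edgeFinset.toList.foldl D.step m))))
      fun x i => (hA _ _ (isEdgeStream_append (hdisj x i))).trans <|
        MeasureTheory.measure_mono fun D hD => by
          have := hdec x i _ hD
          rw [StreamAlg.run, List.foldl_append] at this
          rw [Set.mem_ofPred_eq, Bool.eq_iff_iff, decide_eq_true_eq, this]
  rw [Fintype.card_fun, Fintype.card_bool, Fintype.card_fin, ← pow_mul] at hpow
  rw [mul_comm]
  exact (Nat.pow_le_pow_iff_right one_lt_two).1 hpow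

/-- The bipartite graph with parts `ι` and `κ` whose edges are the pairs in `E`. -/
def bipartiteGraph {ι κ : Type*} (E : Set (ι × κ)) : SimpleGraph (ι ⊕ κ) :=
  .fromEdgeSet ((fun e => s(.inl e.1, .inr e.2)) '' E)

lemma bipartiteGraph_adj_inl_inr {ι κ : Type*} {E : Set (ι × κ)} {i : ι} {j : κ} :
    (bipartiteGraph E).Adj (.inl i) (.inr j) ↔ (i, j) ∈ E := by
  simp [bipartiteGraph]

lemma card_mul_card_le_of_solves {n s : ℕ} {Out : Type} {ι κ : Type*} [Fintype ι] [Fintype κ]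
    {A : RandStreamAlg n s Out} {Good : SimpleGraph (Fin n) → Out → Prop} (hA : A.Solves Good)
    (B : Fin n → Option (ι ⊕ κ)) (dec : ι → κ → Out → Prop)
    (hdec : ∀ H i j o, Good (gadget B H (.inl i) (.inr j)) o →
      (H.Adj (.inl i) (.inr j) ↔ dec i j o)) :
    Fintype.card ι * Fintype.card κ ≤ 15 * s := by
  rw [← Fintype.card_prod]
  exact card_le_of_solves hA (fun x => blowUp B (bipartiteGraph {e | x e = true}))
    (fun e => queryGraph B (.inl e.1) (.inr e.2)) (fun _ _ => disjoint_blowUp_queryGraph)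
    (fun e => dec e.1 e.2) fun x e o ho => by
      rw [← hdec _ _ _ _ ho, bipartiteGraph_adj_inl_inr, Set.mem_ofPred_eq]

end Streams

section Tasks

variable {n s b q : ℕ} {lam : ℕ → ℕ} {ι κ : Type*} [Fintype ι] [Fintype κ]
  {B : Fin n → Option (ι ⊕ κ)}

lemma card_mul_card_le_of_coloringInSpace (hB : IsBlockPartition B b q) (hq : n ≤ 2 * q)
    (hb : 1 ≤ b) (hlam : lam (q + b - 1) ≤ b) (h : ColoringInSpace n s lam) :
    Fintype.card ι * Fintype.card κ ≤ 15 * s := by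
  obtain ⟨A, hA⟩ := h
  refine card_mul_card_le_of_solves hA B
    (fun i j col => ∀ u v, B u = some (.inl i) → B v = some (.inr j) → col u ≠ col v) ?_
  rintro H i j col ⟨hcol, hcard⟩
  refine hB.adj_iff_forall_map_ne Sum.inl_ne_inr hcol fun hij => ?_
  rw [hB.degeneracy_gadget_of_not_adj (by simpa using hq) hb Sum.inl_ne_inr hij] at hcard
  rw [← Set.image_univ, ← Finset.coe_univ, ← Finset.coe_image, Set.ncard_coe_finset]
  omega

lemma card_mul_card_le_of_estimationInSpace (hB : IsBlockPartition B b q) (hq : n ≤ 2 * q)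
    (hlam : lam (q + b - 1) + lam (q + 2 * b - 1) < b) (h : EstimationInSpace n s lam) :
    Fintype.card ι * Fintype.card κ ≤ 15 * s := by
  have hb : 1 ≤ b := by omega
  replace hq : Nat.card (Fin n) ≤ 2 * q := by simpa using hq
  obtain ⟨A, hA⟩ := h
  refine card_mul_card_le_of_solves hA B
    (fun _ _ est => ((q + b - 1 + lam (q + b - 1) : ℕ) : ℝ) < est) fun H i j est hest => ?_
  rw [abs_le] at hest
  by_cases hij : H.Adj (.inl i) (.inr j)
  · rw [hB.degeneracy_gadget_of_adj hq hb hij] at hest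
    have : q + b - 1 + lam (q + b - 1) + lam (q + 2 * b - 1) < q + 2 * b - 1 := by omega
    have : ((q + b - 1 + lam (q + b - 1) : ℕ) : ℝ) + lam (q + 2 * b - 1) < (q + 2 * b - 1 : ℕ) := by
      exact_mod_cast this
    simp only [hij, true_iff]
    linarith
  · rw [hB.degeneracy_gadget_of_not_adj hq hb Sum.inl_ne_inr hij] at hest
    simp only [hij, false_iff, not_lt, Nat.cast_add]
    linarith

end Tasks

section SpaceBound

lemma sq_le_of_coloringInSpace_or_estimationInSpace {n s b L : ℕ} {lam : ℕ → ℕ}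
    (hb : 2 * L < b) (hn : 4 * b ≤ n) (hlam : ∀ k, n ≤ 2 * k → k < n → lam k ≤ L)
    (h : ColoringInSpace n s lam ∨ EstimationInSpace n s lam) :
    n ^ 2 ≤ 960 * b ^ 2 * s := by
  -- The largest `p` for which `p + p` blocks of size `b` leave half of the vertices to the hub.
  set p := n / (4 * b)
  have hp : 1 ≤ p := (Nat.one_le_div_iff (by omega)).2 hn
  have hpn : 4 * (p * b) ≤ n := (mul_left_comm ..).trans_le (Nat.div_mul_le_self _ _)
  have hbp : b ≤ p * b := Nat.le_mul_of_pos_left _ hp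
  have hcard : Fintype.card (Fin p ⊕ Fin p) * b + (n - 2 * (p * b)) = Fintype.card (Fin n) := by
    rw [Fintype.card_sum, Fintype.card_fin, Fintype.card_fin, ← two_mul, mul_assoc]
    omega
  obtain ⟨B, hB⟩ := exists_isBlockPartition hcard
  have hq : n ≤ 2 * (n - 2 * (p * b)) := by omega
  have hlam₁ := hlam (n - 2 * (p * b) + b - 1) (by omega) (by omega)
  have hlam₂ := hlam (n - 2 * (p * b) + 2 * b - 1) (by omega) (by omega)
  have hbits : Fintype.card (Fin p) * Fintype.card (Fin p) ≤ 15 * s :=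
    h.elim (card_mul_card_le_of_coloringInSpace hB hq (by omega) (by omega))
      (card_mul_card_le_of_estimationInSpace hB hq (by omega))
  rw [Fintype.card_fin] at hbits
  have hnp : n ≤ 8 * b * p := by
    have : n < 4 * b * (p + 1) := Nat.lt_mul_div_succ n (by omega)
    nlinarith
  calc n ^ 2 ≤ (8 * b * p) ^ 2 := by gcongr
    _ = 64 * b ^ 2 * (p * p) := by ring
    _ ≤ 64 * b ^ 2 * (15 * s) := by gcongr
    _ = 960 * b ^ 2 * s := by ring

lemma sq_div_sq_le_of_coloringInSpace_or_estimationInSpace {n s L : ℕ} (hL : 1 ≤ L)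
    (hn : 12 * L ≤ n)
    (h : ColoringInSpace n s (fun _ => L) ∨ EstimationInSpace n s (fun _ => L)) :
    (n : ℝ) ^ 2 / L ^ 2 ≤ 8640 * s := by
  have hsq : n ^ 2 ≤ 960 * (3 * L) ^ 2 * s :=
    sq_le_of_coloringInSpace_or_estimationInSpace (by omega) (by omega) (fun _ _ _ => le_rfl) h
  rw [div_le_iff₀ (by positivity)]
  calc (n : ℝ) ^ 2 ≤ 960 * (3 * (L : ℝ)) ^ 2 * (s : ℝ) := by exact_mod_cast hsq
    _ = 8640 * (s : ℝ) * (L : ℝ) ^ 2 := by ring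

end SpaceBound

section Asymptotics

lemma exists_isBigO_eventually_forall_le {δ : ℝ} (hδ : 0 ≤ δ) {f : ℕ → ℕ}
    (hf : (fun k => (f k : ℝ)) =O[atTop] fun k : ℕ => (k : ℝ) ^ δ) :
    ∃ g : ℕ → ℕ, ((fun n => (g n : ℝ)) =O[atTop] fun n : ℕ => (n : ℝ) ^ δ) ∧
      ∀ᶠ n in atTop, ∀ k, n ≤ 2 * k → k ≤ n → f k ≤ g n := by
  obtain ⟨C, hC0, hC⟩ := hf.exists_pos
  obtain ⟨K, hK⟩ := eventually_atTop.1 hC.bound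
  refine ⟨fun n => ⌊C * (n : ℝ) ^ δ⌋₊, .of_bound C (.of_forall fun n => ?_), ?_⟩
  · rw [Real.norm_of_nonneg (by positivity), Real.norm_of_nonneg (by positivity)]
    exact Nat.floor_le (by positivity)
  · filter_upwards [eventually_ge_atTop (2 * K)] with n hn k hnk hkn
    have hfk := hK k (by omega)
    rw [Real.norm_of_nonneg (by positivity), Real.norm_of_nonneg (by positivity)] at hfk
    exact Nat.le_floor (hfk.trans (by gcongr))

lemma isBigO_natCast_rpow_rpow {a b : ℝ} (h : a ≤ b) :
    (fun n : ℕ => (n : ℝ) ^ a) =O[atTop] fun n : ℕ => (n : ℝ) ^ b := by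
  refine .of_bound 1 ?_
  filter_upwards [eventually_ge_atTop 1] with n hn
  rw [Real.norm_of_nonneg (by positivity), Real.norm_of_nonneg (by positivity), one_mul]
  exact Real.rpow_le_rpow_of_exponent_le (by exact_mod_cast hn) h

lemma isLittleO_natCast_rpow_rpow {a b : ℝ} (h : a < b) :
    (fun n : ℕ => (n : ℝ) ^ a) =o[atTop] fun n : ℕ => (n : ℝ) ^ b := by
  have hone : (fun _ : ℕ => (1 : ℝ)) =o[atTop] fun n : ℕ => (n : ℝ) ^ (b - a) :=
    isLittleO_const_left.2 <| .inr <| tendsto_norm_atTop_atTop.comp <|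
      (tendsto_rpow_atTop (sub_pos.2 h)).comp tendsto_natCast_atTop_atTop
  refine ((isBigO_refl (fun n : ℕ => (n : ℝ) ^ a) atTop).mul_isLittleO hone).congr' (by simp) ?_
  filter_upwards [eventually_gt_atTop 0] with n hn
  rw [← Real.rpow_add (by exact_mod_cast hn), add_sub_cancel]

lemma IsSemiStreaming.isLittleO_rpow {s : ℕ → ℕ} (hs : IsSemiStreaming s) {a : ℝ} (ha : 1 < a) :
    (fun n => (s n : ℝ)) =o[atTop] fun n : ℕ => (n : ℝ) ^ a := by
  obtain ⟨k, hk⟩ := hs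
  have hlog : (fun n : ℕ => Real.log n ^ k) =o[atTop] fun n : ℕ => (n : ℝ) ^ (a - 1) := by
    simpa [Function.comp_def] using (isLittleO_log_rpow_rpow_atTop (k : ℝ)
      (sub_pos.2 ha)).comp_tendsto (tendsto_natCast_atTop_atTop (R := ℝ))
  refine hk.trans_isLittleO (((isBigO_refl _ _).mul_isLittleO hlog).congr_right fun n => ?_)
  rw [← Real.rpow_one_add' (by positivity) (by linarith)]
  congr 1
  ring

lemma eventually_not_coloringInSpace_and_not_estimationInSpace {δ : ℝ} (hδ₀ : 0 ≤ δ) (hδ₁ : δ < 1)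
    {lam s : ℕ → ℕ} (hlam : (fun k => (lam k : ℝ)) =O[atTop] fun k : ℕ => (k : ℝ) ^ δ)
    (hs : (fun n => (s n : ℝ)) =o[atTop] fun n : ℕ => (n : ℝ) ^ (2 - 2 * δ)) :
    ∀ᶠ n in atTop, ¬ ColoringInSpace n (s n) lam ∧ ¬ EstimationInSpace n (s n) lam := by
  obtain ⟨L, hLO, hL⟩ := exists_isBigO_eventually_forall_le hδ₀ hlam
  have hb : (fun n => (2 * L n + 1 : ℝ)) =O[atTop] fun n : ℕ => (n : ℝ) ^ δ :=
    (hLO.const_mul_left 2).add (by simpa using isBigO_natCast_rpow_rpow hδ₀)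
  have hsmall : (fun n => (2 * L n + 1 : ℝ)) =o[atTop] fun n : ℕ => (n : ℝ) := by
    refine hb.trans_isLittleO ?_
    simpa using isLittleO_natCast_rpow_rpow hδ₁
  have hspace : (fun n => (2 * L n + 1 : ℝ) ^ 2 * s n) =o[atTop] fun n : ℕ => (n : ℝ) ^ 2 := by
    refine ((hb.pow 2).mul_isLittleO hs).congr' .rfl ?_
    filter_upwards [eventually_gt_atTop 0] with n hn
    rw [← Real.rpow_mul_natCast (by positivity), ← Real.rpow_add (by exact_mod_cast hn),
      ← Real.rpow_natCast]
    congr 1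
    push_cast
    ring
  filter_upwards [hL, hsmall.bound (c := 1 / 4) (by norm_num),
    hspace.bound (c := 1 / 961) (by norm_num), eventually_gt_atTop 0] with n hLn hsmall hspace hn
  rw [← not_or]
  intro h
  rw [Real.norm_of_nonneg (by positivity), Real.norm_of_nonneg (by positivity)] at hsmall hspace
  have hsq := sq_le_of_coloringInSpace_or_estimationInSpace (Nat.lt_succ_self (2 * L n))
    (by exact_mod_cast (by linarith : (4 * (2 * L n + 1) : ℝ) ≤ n))
    (fun k hnk hkn => hLn k hnk hkn.le) h
  have hsq' : (n : ℝ) ^ 2 ≤ 960 * (2 * L n + 1) ^ 2 * s n := by exact_mod_cast hsq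
  have : (0 : ℝ) < (n : ℝ) ^ 2 := by positivity
  linarith

end Asymptotics

theorem mainTheorem4 :
    (∃ c : ℝ, 0 < c ∧ ∃ C : ℕ, ∀ lam : ℕ, 1 ≤ lam → ∀ n : ℕ, C * lam ≤ n → ∀ s : ℕ,
      (ColoringInSpace n s (fun _ => lam) → c * ((n : ℝ) ^ 2 / (lam : ℝ) ^ 2) ≤ (s : ℝ)) ∧
      (EstimationInSpace n s (fun _ => lam) → c * ((n : ℝ) ^ 2 / (lam : ℝ) ^ 2) ≤ (s : ℝ))) ∧
    (∀ γ : ℝ, 0 < γ → ∀ lam : ℕ → ℕ, (∀ k, 1 ≤ lam k) →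
      ((fun k => (lam k : ℝ)) =O[atTop] fun k : ℕ => (k : ℝ) ^ (1 / 2 - γ)) →
      ∀ s : ℕ → ℕ, IsSemiStreaming s →
        ∀ᶠ n : ℕ in atTop,
          ¬ ColoringInSpace n (s n) lam ∧ ¬ EstimationInSpace n (s n) lam) := by
  refine ⟨⟨1 / 8640, by norm_num, 12, fun lam hlam n hn s => ?_⟩, fun γ hγ lam _ hO s hs => ?_⟩
  · rw [← or_imp]
    intro h
    have := sq_div_sq_le_of_coloringInSpace_or_estimationInSpace hlam hn h
    linarith
  · have hδ : max (1 / 2 - γ) 0 < 1 / 2 := max_lt (by linarith) (by norm_num)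
    exact eventually_not_coloringInSpace_and_not_estimationInSpace (le_max_right _ _) (by linarith)
      (hO.trans (isBigO_natCast_rpow_rpow (le_max_left _ _))) (hs.isLittleO_rpow (by linarith))
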